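/- For a graph $G$ let $A(G)$ be its adjacency matrix, $D(G)$ the diagonal matrix of its vertex degrees, and $q(G)$ the largest eigenvalue of the signless Laplacian matrix $Q(G)=D(G)+A(G)$. Let $\delta(G)$ and $\Delta(G)$ denote the minimum and maximum degree of $G$. For $1\le k\le n$ let $H_{n,k}$ be the $n$-vertex graph consisting of an $(n-1)$-clique together with one additional vertex that is adjacent to exactly $k-1$ vertices of the clique, that is, $H_{n,k}=K_{k-1}\vee(K_{n-k}\cup K_1)$. A graph is $F$-free if it does not contain $F$ as a (not necessarily induced) subgraph. **Theorem.** There is an integer $n_0$ such that the following holds for every $n\ge n_0$. Let $F$ be any $n$-vertex graph with no isolated vertices and $\Delta(F)\le\sqrt n/40$, and put $\delta=\delta(F)$. Then $H_{n,\delta}$ is $F$-free, and every $n$-vertex $F$-free graph $G$ satisfies $$q(G)\le q(H_{n,\delta}),$$ with equality if and only if $G$ is isomorphic to $H_{n,\delta}$. -/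

import Mathlib

namespace SignlessLaplacian

/-- The signless Laplacian matrix `Q(G) = D(G) + A(G)`, over the reals. -/
def signlessLapMatrix {V : Type*} [Fintype V] [DecidableEq V]
    (G : SimpleGraph V) [DecidableRel G.Adj] : Matrix V V ℝ :=
  G.degMatrix ℝ + G.adjMatrix ℝ

/-- `q(G)`, the largest eigenvalue of `Q(G)`. As `Q(G)` is a real symmetric matrix, its spectrum
is the finite set of its eigenvalues (nonempty if `V` is), so the supremum is a maximum. -/
noncomputable def signlessRadius {V : Type*} [Fintype V] [DecidableEq V]
    (G : SimpleGraph V) [DecidableRel G.Adj] : ℝ :=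
  sSup (spectrum ℝ (signlessLapMatrix G))

/-- The graph `H_{n,k}` for `1 ≤ k ≤ n`: the vertices other than `0` form an `(n-1)`-clique, and
the vertex `0` is joined exactly to the `k - 1` vertices `1, …, k - 1`. -/
def cliquePendant (n k : ℕ) : SimpleGraph (Fin n) where
  Adj i j := i ≠ j ∧ (i.val = 0 → j.val < k) ∧ (j.val = 0 → i.val < k)
  symm := ⟨fun _ _ h => ⟨h.1.symm, h.2.2, h.2.1⟩⟩
  loopless := ⟨fun _ h => h.1 rfl⟩

instance (n k : ℕ) : DecidableRel (cliquePendant n k).Adj := fun i j =>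
  inferInstanceAs (Decidable (i ≠ j ∧ (i.val = 0 → j.val < k) ∧ (j.val = 0 → i.val < k)))

end SignlessLaplacian

/-!
Let `n = N + 1`, let `k = F.minDegree - 1`, and let `C` be the complement of an `F`-free graph `G`.

*Combinatorial part.* If `C` has fewer than `n - F.minDegree` edges, then `F` embeds in `G`, that
is, `F` and `C` pack (`exists_packing`). Vertices of small degree in `C` cause no trouble: in a
bijection with the fewest conflicts, one conflicting vertex can be exchanged with some other vertex
(`exists_perm_no_conflict`), by the counting of Sauer and Spencer. The few vertices of large degree
in `C` are matched beforehand. The one of largest degree, `a`, receives a vertex `w` of minimum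
degree of `F`, and the neighbours of `w` go to independent non-neighbours of `a`, which exist by
`exists_indep_of_nonneighbors`; the others have degree at most `n / 2` and receive vertices of `F`
that are spread out (`exists_spread_placement`).

*Spectral part.* So `C` has at least `N - k` edges. The extremal graph satisfies
`q ≥ 2 * N - 2 + k / N`. If some vertex of `G` has degree at most `k`, then `G` is isomorphic to a
subgraph of the extremal graph, and equality is settled by a nonnegative maximizing vector
(`nonempty_iso_of_signlessRadius_eq`). Otherwise `q(G) < 2 * N - 2 + k / N`, where `C` may be
assumed to have exactly `N - k` edges (`signlessRadius_lt_of_card_edges`). Weighted Cauchy-Schwarz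
(`signlessForm_le_of_weights`) handles the case of a `C` with all degrees `O(√N)`. If a vertex `a`
has larger degree in `C`, the Feng-Yu bound is applied to `G - a` (`signlessForm_le_of_isolated`),
and the edges of `G` at `a` are estimated by bounding the entries of an eigenvector
(`signlessRadius_le_of_star`). The other edges of `C` lower `q(G)` by more than the extra edges at
`a` can raise it (`star_bound_lt`).
-/

namespace SignlessLaplacian

open Finset

/-! ### Packing a graph of bounded degree with a graph having few edges -/

section Packing

variable {V : Type*} [Fintype V] [DecidableEq V]

/-- Among the non-neighbours of `a`, delete for every edge of `C` avoiding `a` its endpoint of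
larger degree. The vertices left over are pairwise non-adjacent, and all neighbours of such a vertex
have at least its degree, so its degree is bounded by the number of vertices with that property. -/
theorem exists_indep_of_nonneighbors (C : SimpleGraph V) [DecidableRel C.Adj] (a : V) (d : ℕ)
    (he : #C.edgeFinset + d + 1 ≤ Fintype.card V) :
    ∃ I : Finset V, #I = d ∧ (∀ u ∈ I, u ≠ a ∧ ¬ C.Adj a u) ∧
      (∀ u ∈ I, ∀ v ∈ I, ¬ C.Adj u v) ∧
      ∀ u ∈ I, C.degree u ≤ #{v | C.degree u ≤ C.degree v} := by
  have hch : ∀ e : Sym2 V, ∃ v ∈ e, ∀ u ∈ e, C.degree u ≤ C.degree v := by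
    intro e
    induction e using Sym2.ind with
    | _ x y =>
      rcases le_total (C.degree x) (C.degree y) with h | h
      · exact ⟨y, by simp, by simp [h]⟩
      · exact ⟨x, by simp, by simp [h]⟩
  choose top htop hmax using hch
  set R : Finset V := (C.edgeFinset \ C.incidenceFinset a).image top with hR
  set U : Finset V := univ \ (insert a (C.neighborFinset a)) with hU
  have hinc : C.incidenceFinset a ⊆ C.edgeFinset := C.incidenceFinset_subset a
  have hRcard : #R + C.degree a ≤ #C.edgeFinset := by
    have h1 : #R ≤ #(C.edgeFinset \ C.incidenceFinset a) := card_image_le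
    have h2 := card_sdiff_add_card_eq_card hinc
    rw [C.card_incidenceFinset_eq_degree] at h2
    omega
  have hUcard : #U + C.degree a + 1 = Fintype.card V := by
    have h2 := card_sdiff_add_card_eq_card (subset_univ (insert a (C.neighborFinset a)))
    rw [card_insert_of_notMem (by simp), C.card_neighborFinset_eq_degree, card_univ] at h2
    omega
  have hcard : d ≤ #(U \ R) := by
    have := le_card_sdiff R U
    omega
  obtain ⟨I, hI, hId⟩ := exists_subset_card_eq hcard
  have hIU : ∀ u ∈ I, u ≠ a ∧ ¬ C.Adj a u := by
    intro u hu
    have := hI hu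
    simp only [hU, mem_sdiff, mem_univ, mem_insert, true_and, not_or,
      SimpleGraph.mem_neighborFinset] at this
    exact this.1
  have hIR : ∀ u ∈ I, u ∉ R := fun u hu => (mem_sdiff.1 (hI hu)).2
  have hedge : ∀ u ∈ I, ∀ v, C.Adj u v → v ≠ a → top s(u, v) = v := by
    intro u hu v huv hva
    have hmem : top s(u, v) ∈ R := by
      refine mem_image_of_mem _ ?_
      simp only [mem_sdiff, SimpleGraph.mem_edgeFinset, SimpleGraph.mem_edgeSet, huv, true_and,
        SimpleGraph.mem_incidenceFinset, SimpleGraph.mk'_mem_incidenceSet_iff, not_or]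
      exact ⟨(hIU u hu).1.symm, hva.symm⟩
    rcases Sym2.mem_iff.1 (htop s(u, v)) with h | h
    · exact absurd (h ▸ hmem) (hIR u hu)
    · exact h
  have hnb : ∀ u ∈ I, ∀ v, C.Adj u v → v ≠ a := by
    rintro u hu v huv rfl
    exact (hIU u hu).2 huv.symm
  refine ⟨I, hId, hIU, ?_, ?_⟩
  · intro u hu v hv huv
    have h1 := hedge u hu v huv (hIU v hv).1
    have h2 := hedge v hv u huv.symm (hIU u hu).1
    rw [Sym2.eq_swap, h1] at h2
    exact huv.ne h2.symm
  · intro u hu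
    rw [← C.card_neighborFinset_eq_degree u]
    refine card_le_card fun v hv => ?_
    rw [SimpleGraph.mem_neighborFinset] at hv
    have h := hmax s(u, v) u (by simp)
    rw [hedge u hu v hv (hnb u hu v hv)] at h
    exact mem_filter.2 ⟨mem_univ v, h⟩

/-- A bijection `φ` of the vertices of `C` onto those of `F` that follows `p` on `P` and maps the
fewest edges of `C` to edges of `F` maps none to an edge, provided that every `u` outside
`P` can be exchanged with some `v` without creating a conflict. The terms of `hroom` count the `v`
that cannot serve. -/
theorem exists_perm_no_conflict (F C : SimpleGraph V) [DecidableRel F.Adj] [DecidableRel C.Adj]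
    (P : Finset V) (p : V → V) (hinj : Set.InjOn p P)
    (hP : ∀ u ∈ P, ∀ v ∈ P, C.Adj u v → ¬ F.Adj (p u) (p v))
    (hroom : ∀ φ : Equiv.Perm V, (∀ u ∈ P, φ u = p u) → ∀ u ∉ P,
      #P + C.degree u * (F.maxDegree + 1)
        + ∑ x ∈ F.neighborFinset (φ u), C.degree (φ.symm x) < Fintype.card V) :
    ∃ φ : Equiv.Perm V, ∀ u v, C.Adj u v → ¬ F.Adj (φ u) (φ v) := by
  obtain ⟨φ₀, hφ₀⟩ : ∃ φ : Equiv.Perm V, ∀ u ∈ P, φ u = p u := by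
    obtain ⟨g, hg⟩ := Finset.exists_equiv_extend_of_card_eq (t := (univ : Finset V))
      (by simp) (s := P) (f := p) (subset_univ _) hinj
    exact ⟨g.trans (Equiv.subtypeUnivEquiv (by simp)), fun u hu => by simpa using hg u hu⟩
  let S : Finset (Equiv.Perm V) := {φ | ∀ u ∈ P, φ u = p u}
  let bad : Equiv.Perm V → Finset (V × V) := fun φ =>
    {e | C.Adj e.1 e.2 ∧ F.Adj (φ e.1) (φ e.2)}
  obtain ⟨φ, hφS, hmin⟩ := S.exists_min_image (fun φ => #(bad φ)) ⟨φ₀, by simpa [S] using hφ₀⟩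
  have hφ : ∀ u ∈ P, φ u = p u := by simpa [S] using hφS
  refine ⟨φ, ?_⟩
  by_contra! hcon
  obtain ⟨u, u₀, huu₀, hFuu₀, huP⟩ : ∃ u u₀, C.Adj u u₀ ∧ F.Adj (φ u) (φ u₀) ∧ u ∉ P := by
    obtain ⟨u, v, huv, hF⟩ := hcon
    by_cases hu : u ∈ P
    · by_cases hv : v ∈ P
      · exact absurd (hφ u hu ▸ hφ v hv ▸ hF) (hP u hu v hv huv)
      · exact ⟨v, u, huv.symm, hF.symm, hv⟩
    · exact ⟨u, v, huv, hF, hu⟩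
  -- the vertices that cannot be exchanged with `u`
  let B₁ : Finset V := (C.neighborFinset u).biUnion
    fun u' => (F.neighborFinset (φ u')).map φ.symm.toEmbedding
  let B₂ : Finset V := (F.neighborFinset (φ u)).biUnion fun x => C.neighborFinset (φ.symm x)
  have hB₁ : #B₁ ≤ C.degree u * F.maxDegree := by
    refine (card_biUnion_le_card_mul _ _ F.maxDegree fun u' _ => ?_).trans_eq
      (by rw [C.card_neighborFinset_eq_degree])
    rw [card_map, F.card_neighborFinset_eq_degree]
    exact F.degree_le_maxDegree _
  have hB₂ : #B₂ ≤ ∑ x ∈ F.neighborFinset (φ u), C.degree (φ.symm x) := by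
    refine card_biUnion_le.trans_eq ?_
    simp
  obtain ⟨v, hv⟩ : ∃ v, v ∉ P ∪ C.neighborFinset u ∪ B₁ ∪ B₂ := by
    by_contra! h
    have h1 : univ ⊆ P ∪ C.neighborFinset u ∪ B₁ ∪ B₂ := fun v _ => h v
    have h2 := card_le_card h1
    have h3 := card_union_le (P ∪ C.neighborFinset u ∪ B₁) B₂
    have h4 := card_union_le (P ∪ C.neighborFinset u) B₁
    have h5 := card_union_le P (C.neighborFinset u)
    rw [C.card_neighborFinset_eq_degree] at h5
    have h6 := hroom φ hφ u huP
    rw [card_univ] at h2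
    rw [mul_add, mul_one] at h6
    omega
  simp only [mem_union, not_or] at hv
  obtain ⟨⟨⟨hvP, hvu⟩, hv₁⟩, hv₂⟩ := hv
  rw [SimpleGraph.mem_neighborFinset] at hvu
  have hv₁' : ∀ u', C.Adj u u' → ¬ F.Adj (φ u') (φ v) := by
    intro u' h1 h2
    refine hv₁ (mem_biUnion.2 ⟨u', by simpa using h1, ?_⟩)
    simpa [Equiv.symm_apply_eq] using h2
  have hv₂' : ∀ v', F.Adj (φ u) (φ v') → ¬ C.Adj v' v := by
    intro v' h1 h2
    exact hv₂ (mem_biUnion.2 ⟨φ v', by simpa using h1, by simpa using h2⟩)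
  have huv : u ≠ v := by
    rintro rfl
    exact hv₁' u₀ huu₀ hFuu₀.symm
  set ψ : Equiv.Perm V := (Equiv.swap u v).trans φ with hψ
  have hψu : ψ u = φ v := by simp [hψ]
  have hψv : ψ v = φ u := by simp [hψ]
  have hψo : ∀ x, x ≠ u → x ≠ v → ψ x = φ x := fun x h1 h2 => by
    simp [hψ, Equiv.swap_apply_of_ne_of_ne h1 h2]
  have hψS : ψ ∈ S := by
    simp only [S, mem_filter, mem_univ, true_and]
    intro x hx
    rw [hψo x (by rintro rfl; exact huP hx) (by rintro rfl; exact hvP hx), hφ x hx]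
  -- after the exchange no conflict touches `u` or `v`
  have hu' : ∀ x, C.Adj u x → ¬ F.Adj (ψ u) (ψ x) := by
    intro x hx
    rw [hψu, hψo x hx.ne' (by rintro rfl; exact hvu hx)]
    exact fun h => hv₁' x hx h.symm
  have hv' : ∀ x, C.Adj v x → ¬ F.Adj (ψ v) (ψ x) := by
    intro x hx
    rw [hψv, hψo x (by rintro rfl; exact hvu hx.symm) hx.ne']
    exact fun h => hv₂' x h hx.symm
  have hlt : #(bad ψ) < #(bad φ) := by
    refine card_lt_card (ssubset_iff_of_subset ?_ |>.2 ⟨(u, u₀), ?_, ?_⟩)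
    · rintro ⟨x, y⟩ hxy
      simp only [bad, mem_filter, mem_univ, true_and] at hxy ⊢
      obtain ⟨h1, h2⟩ := hxy
      have hxu : x ≠ u := by rintro rfl; exact hu' y h1 h2
      have hxv : x ≠ v := by rintro rfl; exact hv' y h1 h2
      have hyu : y ≠ u := by rintro rfl; exact hu' x h1.symm h2.symm
      have hyv : y ≠ v := by rintro rfl; exact hv' x h1.symm h2.symm
      rw [hψo x hxu hxv, hψo y hyu hyv] at h2
      exact ⟨h1, h2⟩
    · simp [bad, huu₀, hFuu₀]
    · simp only [bad, mem_filter, mem_univ, true_and, not_and]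
      exact fun _ => hu' u₀ huu₀
  exact absurd (hmin ψ hψS) (not_le.2 hlt)

/-- Greedy placement of the weighted elements `b` of `S` at vertices `z b` of `F`, pairwise
non-adjacent and outside `N`, such that no vertex sees more than `9/16` of `card V` in its
neighbourhood. Each new `z b` is chosen so that all its neighbours have seen at most `1/16` before;
by double counting at most `32 * F.maxDegree` vertices have seen more. -/
theorem exists_spread_placement (F : SimpleGraph V) [DecidableRel F.Adj] (c : V → ℕ)
    (N S : Finset V) (hc : ∀ b ∈ S, 2 * c b ≤ Fintype.card V)
    (hsum : ∑ b ∈ S, c b ≤ 2 * Fintype.card V)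
    (hroom : #N + #S * (F.maxDegree + 1) + 32 * F.maxDegree * F.maxDegree < Fintype.card V) :
    ∃ z : V → V, Set.InjOn z S ∧ (∀ b ∈ S, z b ∉ N) ∧
      (∀ b ∈ S, ∀ b' ∈ S, ¬ F.Adj (z b) (z b')) ∧
      ∀ x, 16 * ∑ b ∈ S with F.Adj x (z b), c b ≤ 9 * Fintype.card V := by
  induction S using Finset.induction with
  | empty => exact ⟨id, by simp⟩
  | insert b S hb ih =>
    rw [sum_insert hb] at hsum
    rw [card_insert_of_notMem hb, add_mul, one_mul] at hroom
    obtain ⟨z, hzinj, hzN, hzind, hzload⟩ := ih (fun b hb => hc b (mem_insert_of_mem hb))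
      (by omega) (by omega)
    set n := Fintype.card V with hn
    let load : V → ℕ := fun x => ∑ b ∈ S with F.Adj x (z b), c b
    let L : Finset V := {x | n < 16 * load x}
    have htotal : ∑ x, load x ≤ 2 * n * F.maxDegree := by
      calc ∑ x, load x = ∑ x, ∑ b ∈ S, if F.Adj x (z b) then c b else 0 := by
            simp only [load, sum_filter]
        _ = ∑ b ∈ S, ∑ x, if F.Adj x (z b) then c b else 0 := sum_comm
        _ = ∑ b ∈ S, F.degree (z b) * c b := by
            refine sum_congr rfl fun b _ => ?_
            rw [← sum_filter, sum_const, smul_eq_mul, ← F.card_neighborFinset_eq_degree]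
            congr 2
            ext x
            simp [F.adj_comm]
        _ ≤ ∑ b ∈ S, F.maxDegree * c b :=
            sum_le_sum fun b _ => Nat.mul_le_mul_right _ (F.degree_le_maxDegree _)
        _ = F.maxDegree * ∑ b ∈ S, c b := by rw [mul_sum]
        _ ≤ F.maxDegree * (2 * n) := Nat.mul_le_mul_left _ (by omega)
        _ = 2 * n * F.maxDegree := mul_comm _ _
    have hL : #L ≤ 32 * F.maxDegree := by
      have h1 : #L * n ≤ ∑ x ∈ L, 16 * load x := by
        rw [← smul_eq_mul]
        exact card_nsmul_le_sum _ _ _ fun x hx => (mem_filter.1 hx).2.le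
      have h2 : ∑ x ∈ L, 16 * load x ≤ ∑ x, 16 * load x :=
        sum_le_sum_of_subset (subset_univ _)
      rw [← mul_sum univ] at h2
      refine Nat.le_of_mul_le_mul_right (?_ : #L * n ≤ 32 * F.maxDegree * n) (by omega)
      nlinarith
    obtain ⟨t, ht⟩ : ∃ t, t ∉ N ∪ S.image z ∪ S.biUnion (fun b => F.neighborFinset (z b)) ∪
        L.biUnion (fun x => F.neighborFinset x) := by
      by_contra! h
      have h1 := card_le_card (fun v _ => h v : univ ⊆ _)
      have h2 := card_union_le (N ∪ S.image z ∪ S.biUnion (fun b => F.neighborFinset (z b)))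
        (L.biUnion (fun x => F.neighborFinset x))
      have h3 := card_union_le (N ∪ S.image z) (S.biUnion (fun b => F.neighborFinset (z b)))
      have h4 := card_union_le N (S.image z)
      have h5 : #(S.image z) ≤ #S := card_image_le
      have h6 : #(S.biUnion (fun b => F.neighborFinset (z b))) ≤ #S * F.maxDegree :=
        card_biUnion_le_card_mul _ _ _ fun b _ => by
          rw [F.card_neighborFinset_eq_degree]; exact F.degree_le_maxDegree _
      have h7 : #(L.biUnion (fun x => F.neighborFinset x)) ≤ #L * F.maxDegree :=
        card_biUnion_le_card_mul _ _ _ fun b _ => by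
          rw [F.card_neighborFinset_eq_degree]; exact F.degree_le_maxDegree _
      have h8 : #L * F.maxDegree ≤ 32 * F.maxDegree * F.maxDegree := Nat.mul_le_mul_right _ hL
      rw [card_univ] at h1
      rw [mul_add, mul_one] at hroom
      omega
    simp only [mem_union, not_or, mem_image, mem_biUnion, not_exists, not_and,
      SimpleGraph.mem_neighborFinset] at ht
    obtain ⟨⟨⟨htN, htz⟩, htS⟩, htL⟩ := ht
    have hne : ∀ b' ∈ S, b' ≠ b := fun b' hb' h => hb (h ▸ hb')
    refine ⟨Function.update z b t, ?_, ?_, ?_, ?_⟩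
    · rw [coe_insert, Set.injOn_insert (by simpa using hb)]
      refine ⟨fun x hx y hy hxy => ?_, ?_⟩
      · rw [Function.update_of_ne (hne x hx), Function.update_of_ne (hne y hy)] at hxy
        exact hzinj hx hy hxy
      · rintro ⟨x, hx, hxt⟩
        rw [Function.update_of_ne (hne x hx), Function.update_self] at hxt
        exact htz x hx hxt
    · intro x hx
      rcases mem_insert.1 hx with rfl | hx
      · simpa using htN
      · rw [Function.update_of_ne (hne x hx)]
        exact hzN x hx
    · intro x hx y hy
      rcases mem_insert.1 hx with hxb | hxS <;> rcases mem_insert.1 hy with hyb | hyS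
      · simp [hxb, hyb]
      · rw [hxb, Function.update_of_ne (hne y hyS), Function.update_self]
        exact fun h => htS y hyS h.symm
      · rw [hyb, Function.update_of_ne (hne x hxS), Function.update_self]
        exact htS x hxS
      · rw [Function.update_of_ne (hne x hxS), Function.update_of_ne (hne y hyS)]
        exact hzind x hxS y hyS
    · intro x
      have hold : ∑ b' ∈ S with F.Adj x (Function.update z b t b'), c b' = load x := by
        refine sum_congr (filter_congr fun b' hb' => ?_) fun _ _ => rfl
        rw [Function.update_of_ne (hne b' hb')]
      rw [filter_insert, Function.update_self]
      split_ifs with hx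
      · rw [sum_insert (by simp [hb]), hold]
        have h1 : ¬ n < 16 * load x := fun h => htL x (mem_filter.2 ⟨mem_univ x, h⟩) hx
        have h2 := hc b (mem_insert_self _ _)
        omega
      · rw [hold]
        exact hzload x

theorem degree_add_degree_le (C : SimpleGraph V) [DecidableRel C.Adj] {a b : V} (hab : a ≠ b) :
    C.degree a + C.degree b ≤ #C.edgeFinset + 1 := by
  rw [← C.card_incidenceFinset_eq_degree, ← C.card_incidenceFinset_eq_degree,
    ← card_union_add_card_inter]
  refine add_le_add (card_le_card (union_subset (C.incidenceFinset_subset _)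
    (C.incidenceFinset_subset _))) (card_le_one.2 fun e he e' he' => ?_)
  have key : ∀ e ∈ C.incidenceFinset a ∩ C.incidenceFinset b, e = s(a, b) := by
    intro e he
    simp only [mem_inter, SimpleGraph.mem_incidenceFinset] at he
    exact (Sym2.mem_and_mem_iff hab).1 ⟨he.1.2, he.2.2⟩
  rw [key e he, key e' he']

/-- A graph `C` with few edges packs with any graph `F` of bounded degree. A vertex `a` of maximum
degree in `C` receives the vertex `w` of `F`, whose neighbours go to an independent set of
non-neighbours of `a`; the other vertices of large degree receive vertices of `F` that are spread
out. Then all remaining conflicts can be removed by exchanges. -/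
theorem exists_packing (F C : SimpleGraph V) [DecidableRel F.Adj] [DecidableRel C.Adj] (w : V)
    (hΔ : 1 ≤ F.maxDegree) (hn : 1600 * F.maxDegree ^ 2 ≤ Fintype.card V)
    (he : #C.edgeFinset + F.degree w + 1 ≤ Fintype.card V) :
    ∃ φ : Equiv.Perm V, ∀ u v, C.Adj u v → ¬ F.Adj (φ u) (φ v) := by
  have hw := F.degree_le_maxDegree w
  have hle := fun v => F.degree_le_maxDegree v
  set Δ := F.maxDegree with hΔdef
  set n := Fintype.card V with hndef
  have hΔ2 : Δ ≤ Δ ^ 2 := Nat.le_self_pow two_ne_zero Δ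
  have hn0 : 0 < n := by omega
  have : Nonempty V := ⟨w⟩
  obtain ⟨a, -, ha⟩ := (univ : Finset V).exists_max_image (fun v => C.degree v) univ_nonempty
  have hdegsum : ∑ v, C.degree v ≤ 2 * n := by
    rw [C.sum_degrees_eq_twice_card_edges]; omega
  -- outside `Big` degrees are below `n / (16 * Δ)`, so any `Δ` of them add up to at most `n / 16`
  let Big : Finset V := {v | n ≤ 16 * Δ * C.degree v}
  have hBig : #Big ≤ 32 * Δ := by
    have h1 : #Big * n ≤ ∑ x ∈ Big, 16 * Δ * C.degree x := by
      rw [← smul_eq_mul]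
      exact card_nsmul_le_sum _ _ _ fun x hx => (mem_filter.1 hx).2
    have h2 : ∑ x ∈ Big, 16 * Δ * C.degree x ≤ ∑ x, 16 * Δ * C.degree x :=
      sum_le_sum_of_subset (subset_univ _)
    rw [← mul_sum univ] at h2
    refine Nat.le_of_mul_le_mul_right (?_ : #Big * n ≤ 32 * Δ * n) hn0
    nlinarith
  obtain ⟨I, hIcard, hIa, hIind, hIdeg⟩ := exists_indep_of_nonneighbors C a (F.degree w) he
  have hIBig : ∀ u ∈ I, u ∉ Big := by
    intro u hu hub
    have h1 := (mem_filter.1 hub).2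
    have h2 : C.degree u ≤ #Big := (hIdeg u hu).trans <| card_le_card fun v hv =>
      mem_filter.2 ⟨mem_univ v, h1.trans (Nat.mul_le_mul_left _ (mem_filter.1 hv).2)⟩
    have h3 : 16 * Δ * C.degree u ≤ 16 * Δ * (32 * Δ) := Nat.mul_le_mul_left _ (h2.trans hBig)
    nlinarith
  set B : Finset V := Big.erase a with hBdef
  have hBcard : #B ≤ 32 * Δ := (card_le_card (erase_subset _ _)).trans hBig
  -- `F` must have no edge between the vertices placed at `B` and the closed neighbourhood of `w`
  let N : Finset V := insert w (F.neighborFinset w ∪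
    (F.neighborFinset w).biUnion fun y => F.neighborFinset y)
  have hN : #N ≤ 1 + Δ + Δ * Δ := by
    have h1 := card_insert_le w (F.neighborFinset w ∪
      (F.neighborFinset w).biUnion fun y => F.neighborFinset y)
    have h2 := card_union_le (F.neighborFinset w)
      ((F.neighborFinset w).biUnion fun y => F.neighborFinset y)
    have h3 : #((F.neighborFinset w).biUnion fun y => F.neighborFinset y) ≤
        #(F.neighborFinset w) * Δ := card_biUnion_le_card_mul _ _ _ fun b _ => by
      rw [F.card_neighborFinset_eq_degree]; exact hle _
    rw [F.card_neighborFinset_eq_degree] at h2 h3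
    have h4 : F.degree w * Δ ≤ Δ * Δ := Nat.mul_le_mul_right _ hw
    have h5 : #N = #(insert w (F.neighborFinset w ∪
      (F.neighborFinset w).biUnion fun y => F.neighborFinset y)) := rfl
    omega
  obtain ⟨z, hzinj, hzN, hzind, hzload⟩ := exists_spread_placement F (fun v => C.degree v) N B
    (fun b hb => by
      have h1 := degree_add_degree_le C (ne_of_mem_erase hb)
      have h2 := ha b (mem_univ b)
      omega)
    ((sum_le_sum_of_subset (subset_univ B)).trans hdegsum)
    (by
      have h1 : #B * (Δ + 1) ≤ 32 * Δ * (Δ + 1) := Nat.mul_le_mul_right _ hBcard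
      nlinarith)
  have hzw : ∀ b ∈ B, z b ≠ w ∧ ¬ F.Adj w (z b) ∧ ∀ y, F.Adj w y → ¬ F.Adj y (z b) := by
    intro b hb
    have := hzN b hb
    simp only [N, mem_insert, mem_union, mem_biUnion, SimpleGraph.mem_neighborFinset, not_or,
      not_exists, not_and] at this
    exact ⟨this.1, this.2.1, this.2.2⟩
  have hτcard : #I = #(F.neighborFinset w) := by
    rw [hIcard, F.card_neighborFinset_eq_degree]
  let τ := Finset.equivOfCardEq hτcard
  let p : V → V := fun v => if v = a then w else if h : v ∈ I then τ ⟨v, h⟩ else z v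
  have hpa : p a = w := by simp [p]
  have hpI : ∀ u (h : u ∈ I), p u = τ ⟨u, h⟩ := fun u h => by simp [p, (hIa u h).1, h]
  have hpI' : ∀ u ∈ I, F.Adj w (p u) := fun u h => by
    rw [hpI u h, ← SimpleGraph.mem_neighborFinset]; exact (τ ⟨u, h⟩).2
  have hBI : ∀ b ∈ B, b ∉ I := fun b hb h => hIBig b h (mem_of_mem_erase hb)
  have hpB : ∀ b ∈ B, p b = z b := fun b hb => by
    simp [p, ne_of_mem_erase hb, hBI b hb]
  refine exists_perm_no_conflict F C (insert a (I ∪ B)) p ?_ ?_ ?_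
  · intro u hu v hv huv
    simp only [coe_insert, coe_union, Set.mem_insert_iff, Set.mem_union, mem_coe] at hu hv
    rcases hu with rfl | hu | hu <;> rcases hv with rfl | hv | hv
    · rfl
    · rw [hpa] at huv
      exact absurd (huv ▸ hpI' v hv) (F.irrefl)
    · rw [hpa, hpB v hv] at huv
      exact absurd huv.symm (hzw v hv).1
    · rw [hpa] at huv
      exact absurd (huv ▸ hpI' u hu) (F.irrefl)
    · rw [hpI u hu, hpI v hv] at huv
      have := τ.injective (Subtype.ext huv)
      exact congrArg Subtype.val this
    · have := hpI' u hu
      rw [huv, hpB v hv] at this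
      exact absurd this (hzw v hv).2.1
    · rw [hpa, hpB u hu] at huv
      exact absurd huv (hzw u hu).1
    · have := hpI' v hv
      rw [← huv, hpB u hu] at this
      exact absurd this (hzw u hu).2.1
    · rw [hpB u hu, hpB v hv] at huv
      exact hzinj hu hv huv
  · intro u hu v hv huv
    simp only [mem_insert, mem_union] at hu hv
    rcases hu with rfl | hu | hu <;> rcases hv with rfl | hv | hv
    · exact absurd huv C.irrefl
    · exact absurd huv (hIa v hv).2
    · rw [hpa, hpB v hv]
      exact (hzw v hv).2.1
    · exact absurd huv.symm (hIa u hu).2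
    · exact absurd huv (hIind u hu v hv)
    · rw [hpB v hv]
      exact (hzw v hv).2.2 _ (hpI' u hu)
    · rw [hpa, hpB u hu]
      exact fun h => (hzw u hu).2.1 h.symm
    · rw [hpB u hu]
      exact fun h => (hzw u hu).2.2 _ (hpI' v hv) h.symm
    · rw [hpB u hu, hpB v hv]
      exact hzind u hu v hv
  · intro φ hφ u hu
    simp only [mem_insert, mem_union, not_or] at hu
    obtain ⟨hua, huI, huB⟩ := hu
    have hφa : φ a = w := by rw [hφ a (by simp), hpa]
    have hφB : ∀ b ∈ B, φ b = z b := fun b hb => by rw [hφ b (by simp [hb]), hpB b hb]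
    have husmall : 16 * Δ * C.degree u < n := by
      by_contra! h
      exact huB (mem_erase.2 ⟨hua, mem_filter.2 ⟨mem_univ u, h⟩⟩)
    -- the preimages of the neighbours of `w` lie in `I`, so `φ u` is not one of them
    have huw : ¬ F.Adj (φ u) w := by
      intro h
      have hmem : φ u ∈ F.neighborFinset w := by simpa using h.symm
      have h1 : p (τ.symm ⟨φ u, hmem⟩).1 = φ u := by
        rw [hpI _ (τ.symm ⟨φ u, hmem⟩).2]
        simp
      have h2 := hφ (τ.symm ⟨φ u, hmem⟩).1 (by simp)
      rw [h1] at h2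
      exact huI (φ.injective h2 ▸ (τ.symm ⟨φ u, hmem⟩).2)
    have hsplit : ∑ x ∈ F.neighborFinset (φ u), C.degree (φ.symm x) ≤
        ∑ b ∈ B with F.Adj (φ u) (z b), C.degree b +
        ∑ x ∈ F.neighborFinset (φ u) with φ.symm x ∉ B, C.degree (φ.symm x) := by
      rw [← sum_filter_add_sum_filter_not (F.neighborFinset (φ u)) (fun x => φ.symm x ∈ B)]
      gcongr
      refine (sum_map _ φ.symm.toEmbedding fun v => C.degree v).symm.trans_le
        (sum_le_sum_of_subset fun b hb => ?_)
      simp only [mem_map, mem_filter, SimpleGraph.mem_neighborFinset] at hb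
      obtain ⟨x, ⟨hx, hxB⟩, rfl⟩ := hb
      refine mem_filter.2 ⟨hxB, ?_⟩
      have h1 := hφB _ hxB
      rw [Equiv.apply_symm_apply] at h1
      exact h1 ▸ hx
    have hrest : 16 * ∑ x ∈ F.neighborFinset (φ u) with φ.symm x ∉ B, C.degree (φ.symm x) ≤ n := by
      have h1 : ∑ x ∈ F.neighborFinset (φ u) with φ.symm x ∉ B, 16 * Δ * C.degree (φ.symm x) ≤
          #{x ∈ F.neighborFinset (φ u) | φ.symm x ∉ B} • n := by
        refine sum_le_card_nsmul _ _ _ fun x hx => ?_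
        simp only [mem_filter, SimpleGraph.mem_neighborFinset] at hx
        by_contra! h
        refine hx.2 (mem_erase.2 ⟨?_, mem_filter.2 ⟨mem_univ _, h.le⟩⟩)
        intro hxa
        rw [Equiv.symm_apply_eq, hφa] at hxa
        exact huw (hxa ▸ hx.1)
      have h2 : #{x ∈ F.neighborFinset (φ u) | φ.symm x ∉ B} ≤ Δ :=
        (card_le_card (filter_subset _ _)).trans
          ((F.card_neighborFinset_eq_degree _).trans_le (hle _))
      rw [← mul_sum, smul_eq_mul] at h1
      have h3 := h1.trans (Nat.mul_le_mul_right n h2)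
      refine Nat.le_of_mul_le_mul_left (?_ : Δ * _ ≤ Δ * n) hΔ
      linarith
    have hload := hzload (φ u)
    have hPcard : #(insert a (I ∪ B)) ≤ 1 + Δ + 32 * Δ := by
      have h1 := card_insert_le a (I ∪ B)
      have h2 := card_union_le I B
      omega
    have hdeg : C.degree u * (Δ + 1) ≤ C.degree u * (2 * Δ) := Nat.mul_le_mul_left _ (by omega)
    have hdeg' : 16 * Δ * C.degree u = 8 * (C.degree u * (2 * Δ)) := by ring
    rw [← hΔdef]
    omega

end Packing

/-! ### The quadratic form of the signless Laplacian -/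

section Form

open Matrix

variable {V W : Type*} [Fintype V] [Fintype W]

/-- Twice the quadratic form of the signless Laplacian: the sum of `(x i + x j) ^ 2` over the
ordered pairs of adjacent vertices. -/
def signlessForm (G : SimpleGraph V) [DecidableRel G.Adj] (x : V → ℝ) : ℝ :=
  ∑ i, ∑ j, if G.Adj i j then (x i + x j) ^ 2 else 0

theorem sum_sq_pos {x : V → ℝ} (hx : x ≠ 0) : 0 < ∑ i, x i ^ 2 := by
  obtain ⟨i, hi⟩ := Function.ne_iff.1 hx
  exact sum_pos' (fun i _ => sq_nonneg _) ⟨i, mem_univ i, by have : x i ≠ 0 := hi; positivity⟩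

/-- A bound of Collatz-Wielandt type: for positive weights `w`, the Cauchy-Schwarz inequality
`(x i + x j) ^ 2 ≤ (w i + w j) * (x i ^ 2 / w i + x j ^ 2 / w j)` bounds the quadratic form by the
row sums of the weighted matrix. -/
theorem signlessForm_le_of_weights (G : SimpleGraph V) [DecidableRel G.Adj] (w θ x : V → ℝ)
    (hw : ∀ i, 0 < w i) (h : ∀ i, (∑ j, if G.Adj i j then w i + w j else 0) ≤ θ i * w i) :
    signlessForm G x ≤ 2 * ∑ i, θ i * x i ^ 2 := by
  have key : ∀ i j, (x i + x j) ^ 2 ≤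
      (w i + w j) * (x i ^ 2 / w i) + (w i + w j) * (x j ^ 2 / w j) := by
    intro i j
    have hi := hw i
    have hj := hw j
    have : (w i + w j) * (x i ^ 2 / w i) + (w i + w j) * (x j ^ 2 / w j) - (x i + x j) ^ 2 =
        (w j * x i - w i * x j) ^ 2 / (w i * w j) := by
      field_simp
      ring
    have h2 : 0 ≤ (w j * x i - w i * x j) ^ 2 / (w i * w j) := by positivity
    linarith
  have hA : ∑ i, ∑ j, (if G.Adj i j then (w i + w j) * (x i ^ 2 / w i) else 0) ≤
      ∑ i, θ i * x i ^ 2 := by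
    refine sum_le_sum fun i _ => ?_
    have h1 : ∑ j, (if G.Adj i j then (w i + w j) * (x i ^ 2 / w i) else 0) =
        (∑ j, if G.Adj i j then w i + w j else 0) * (x i ^ 2 / w i) := by
      rw [sum_mul]
      refine sum_congr rfl fun j _ => ?_
      split_ifs <;> simp
    rw [h1]
    have h2 : 0 ≤ x i ^ 2 / w i := div_nonneg (sq_nonneg _) (hw i).le
    refine (mul_le_mul_of_nonneg_right (h i) h2).trans_eq ?_
    have := (hw i).ne'
    field_simp
  have hB : ∑ i, ∑ j, (if G.Adj i j then (w i + w j) * (x j ^ 2 / w j) else 0) =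
      ∑ i, ∑ j, (if G.Adj i j then (w i + w j) * (x i ^ 2 / w i) else 0) := by
    rw [sum_comm]
    refine sum_congr rfl fun i _ => sum_congr rfl fun j _ => ?_
    simp only [G.adj_comm i j, add_comm (w i)]
  have hC : signlessForm G x ≤
      ∑ i, ∑ j, (if G.Adj i j then (w i + w j) * (x i ^ 2 / w i) else 0) +
      ∑ i, ∑ j, (if G.Adj i j then (w i + w j) * (x j ^ 2 / w j) else 0) := by
    rw [signlessForm, ← sum_add_distrib]
    refine sum_le_sum fun i _ => ?_
    rw [← sum_add_distrib]
    refine sum_le_sum fun j _ => ?_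
    split_ifs
    · exact key i j
    · simp
  linarith

theorem signlessForm_comp_equiv_le (G : SimpleGraph V) [DecidableRel G.Adj] (H : SimpleGraph W)
    [DecidableRel H.Adj] (e : V ≃ W) (he : ∀ i j, G.Adj i j → H.Adj (e i) (e j)) (y : W → ℝ) :
    signlessForm G (y ∘ e) ≤ signlessForm H y := by
  rw [signlessForm, signlessForm, ← e.sum_comp]
  refine sum_le_sum fun i _ => ?_
  rw [← e.sum_comp]
  refine sum_le_sum fun j _ => ?_
  split_ifs with h1 h2 h2
  · exact le_rfl
  · exact absurd (he i j h1) h2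
  · positivity
  · exact le_rfl

theorem signlessForm_le_abs (G : SimpleGraph V) [DecidableRel G.Adj] (x : V → ℝ) :
    signlessForm G x ≤ signlessForm G fun i => |x i| := by
  refine sum_le_sum fun i _ => sum_le_sum fun j _ => ?_
  split_ifs
  · rw [← sq_abs (x i + x j)]
    exact pow_le_pow_left₀ (abs_nonneg _) (abs_add_le _ _) 2
  · exact le_rfl

theorem sum_ite_adj_const_add (C : SimpleGraph V) [DecidableRel C.Adj] (w : V → ℝ) (i : V) :
    (∑ j, if C.Adj i j then w i + w j else 0) =
      C.degree i * w i + ∑ j ∈ C.neighborFinset i, w j := by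
  rw [← sum_filter, ← SimpleGraph.neighborFinset_eq_filter, sum_add_distrib, sum_const,
    nsmul_eq_mul, C.card_neighborFinset_eq_degree]

theorem sum_degree_cast (C : SimpleGraph V) [DecidableRel C.Adj] :
    ∑ v, (C.degree v : ℝ) = 2 * #C.edgeFinset := by
  exact_mod_cast C.sum_degrees_eq_twice_card_edges

variable [DecidableEq V] [DecidableEq W]

theorem signlessLapMatrix_mulVec (G : SimpleGraph V) [DecidableRel G.Adj] (x : V → ℝ) (i : V) :
    (signlessLapMatrix G *ᵥ x) i = ∑ j, if G.Adj i j then x i + x j else 0 := by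
  rw [signlessLapMatrix, Matrix.add_mulVec, Pi.add_apply, SimpleGraph.adjMatrix_mulVec_apply,
    SimpleGraph.degMatrix, Matrix.mulVec_diagonal, ← sum_filter, sum_add_distrib, sum_const,
    nsmul_eq_mul, SimpleGraph.neighborFinset_eq_filter, ← SimpleGraph.card_neighborFinset_eq_degree,
    SimpleGraph.neighborFinset_eq_filter]

theorem signlessForm_eq (G : SimpleGraph V) [DecidableRel G.Adj] (x : V → ℝ) :
    signlessForm G x = 2 * (x ⬝ᵥ signlessLapMatrix G *ᵥ x) := by
  have h1 : x ⬝ᵥ signlessLapMatrix G *ᵥ x =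
      ∑ i, ∑ j, if G.Adj i j then x i * (x i + x j) else 0 := by
    simp only [dotProduct, signlessLapMatrix_mulVec, mul_sum, mul_ite, mul_zero]
  have h2 : x ⬝ᵥ signlessLapMatrix G *ᵥ x =
      ∑ i, ∑ j, if G.Adj i j then x j * (x i + x j) else 0 := by
    rw [h1, sum_comm]
    refine sum_congr rfl fun i _ => sum_congr rfl fun j _ => ?_
    simp only [G.adj_comm i j, add_comm (x i)]
  rw [two_mul]
  nth_rewrite 1 [h1]
  rw [h2, signlessForm, ← sum_add_distrib]
  refine sum_congr rfl fun i _ => ?_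
  rw [← sum_add_distrib]
  refine sum_congr rfl fun j _ => ?_
  split_ifs <;> ring

theorem isHermitian_signlessLapMatrix (G : SimpleGraph V) [DecidableRel G.Adj] :
    (signlessLapMatrix G).IsHermitian := by
  refine Matrix.IsHermitian.add ?_ ?_
  · rw [SimpleGraph.degMatrix]
    exact Matrix.isHermitian_diagonal _
  · rw [Matrix.IsHermitian, Matrix.conjTranspose_eq_transpose_of_trivial]
    exact SimpleGraph.transpose_adjMatrix G

theorem signlessRadius_mem_spectrum [Nonempty V] (G : SimpleGraph V) [DecidableRel G.Adj] :
    signlessRadius G ∈ spectrum ℝ (signlessLapMatrix G) := by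
  have h := (isHermitian_signlessLapMatrix G).spectrum_real_eq_range_eigenvalues
  refine Set.Nonempty.csSup_mem ?_ ?_
  · rw [h]; exact Set.range_nonempty _
  · rw [h]; exact Set.finite_range _

theorem le_signlessRadius (G : SimpleGraph V) [DecidableRel G.Adj] {t : ℝ}
    (ht : t ∈ spectrum ℝ (signlessLapMatrix G)) : t ≤ signlessRadius G := by
  refine le_csSup ?_ ht
  rw [(isHermitian_signlessLapMatrix G).spectrum_real_eq_range_eigenvalues]
  exact (Set.finite_range _).bddAbove

theorem posSemidef_signlessRadius_sub (G : SimpleGraph V) [DecidableRel G.Adj] :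
    (algebraMap ℝ (Matrix V V ℝ) (signlessRadius G) - signlessLapMatrix G).PosSemidef := by
  have hH : (algebraMap ℝ (Matrix V V ℝ) (signlessRadius G) - signlessLapMatrix G).IsHermitian := by
    refine Matrix.IsHermitian.sub ?_ (isHermitian_signlessLapMatrix G)
    rw [Matrix.algebraMap_eq_diagonal]
    exact Matrix.isHermitian_diagonal _
  rw [hH.posSemidef_iff_eigenvalues_nonneg]
  intro i
  have h1 : hH.eigenvalues i ∈
      spectrum ℝ (algebraMap ℝ (Matrix V V ℝ) (signlessRadius G) - signlessLapMatrix G) := by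
    rw [hH.spectrum_real_eq_range_eigenvalues]
    exact Set.mem_range_self i
  rw [← spectrum.singleton_sub_eq, Set.singleton_sub] at h1
  obtain ⟨t, ht, hti⟩ := h1
  have := le_signlessRadius G ht
  change (0 : ℝ) ≤ _
  rw [← hti]
  linarith

theorem sub_dotProduct_eq (G : SimpleGraph V) [DecidableRel G.Adj] (t : ℝ) (x : V → ℝ) :
    2 * (x ⬝ᵥ (algebraMap ℝ (Matrix V V ℝ) t - signlessLapMatrix G) *ᵥ x) =
      2 * t * ∑ i, x i ^ 2 - signlessForm G x := by
  rw [signlessForm_eq, Matrix.sub_mulVec, dotProduct_sub, Algebra.algebraMap_eq_smul_one,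
    Matrix.smul_mulVec, Matrix.one_mulVec, dotProduct_smul, smul_eq_mul, dotProduct]
  simp only [← sq]
  ring

theorem signlessForm_le (G : SimpleGraph V) [DecidableRel G.Adj] (x : V → ℝ) :
    signlessForm G x ≤ 2 * signlessRadius G * ∑ i, x i ^ 2 := by
  have h := (posSemidef_signlessRadius_sub G).dotProduct_mulVec_nonneg x
  rw [star_trivial] at h
  have := sub_dotProduct_eq G (signlessRadius G) x
  linarith

theorem mulVec_eq_of_signlessForm_eq (G : SimpleGraph V) [DecidableRel G.Adj] (x : V → ℝ)
    (hx : signlessForm G x = 2 * signlessRadius G * ∑ i, x i ^ 2) :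
    signlessLapMatrix G *ᵥ x = signlessRadius G • x := by
  have h := (posSemidef_signlessRadius_sub G).dotProduct_mulVec_zero_iff x
  rw [star_trivial] at h
  have h1 := sub_dotProduct_eq G (signlessRadius G) x
  have h2 := h.1 (by linarith)
  rw [Matrix.sub_mulVec, sub_eq_zero, Algebra.algebraMap_eq_smul_one, Matrix.smul_mulVec,
    Matrix.one_mulVec] at h2
  exact h2.symm

theorem exists_eigenvector [Nonempty V] (G : SimpleGraph V) [DecidableRel G.Adj] :
    ∃ x : V → ℝ, x ≠ 0 ∧ signlessLapMatrix G *ᵥ x = signlessRadius G • x := by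
  have h := signlessRadius_mem_spectrum G
  rw [← Matrix.spectrum_toLin', ← Module.End.hasEigenvalue_iff_mem_spectrum] at h
  obtain ⟨x, hx⟩ := h.exists_hasEigenvector
  exact ⟨x, hx.2, by simpa using hx.apply_eq_smul⟩

theorem signlessForm_eq_of_mulVec_eq (G : SimpleGraph V) [DecidableRel G.Adj] {x : V → ℝ} {t : ℝ}
    (hx : signlessLapMatrix G *ᵥ x = t • x) : signlessForm G x = 2 * t * ∑ i, x i ^ 2 := by
  rw [signlessForm_eq, hx, dotProduct_smul, smul_eq_mul, dotProduct]
  simp only [← sq]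
  ring

theorem signlessRadius_le_of_forall [Nonempty V] (G : SimpleGraph V) [DecidableRel G.Adj] {t : ℝ}
    (h : ∀ x, signlessForm G x ≤ 2 * t * ∑ i, x i ^ 2) : signlessRadius G ≤ t := by
  obtain ⟨x, hx0, hx⟩ := exists_eigenvector G
  have h1 := signlessForm_eq_of_mulVec_eq G hx
  have h2 := h x
  rw [h1] at h2
  have := le_of_mul_le_mul_right h2 (sum_sq_pos hx0)
  linarith

theorem signlessRadius_le_of_equiv [Nonempty V] (G : SimpleGraph V) [DecidableRel G.Adj]
    (H : SimpleGraph W) [DecidableRel H.Adj] (e : V ≃ W)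
    (he : ∀ i j, G.Adj i j → H.Adj (e i) (e j)) : signlessRadius G ≤ signlessRadius H := by
  refine signlessRadius_le_of_forall G fun x => ?_
  have h1 := signlessForm_comp_equiv_le G H e he (x ∘ e.symm)
  have h2 := signlessForm_le H (x ∘ e.symm)
  have h3 : (x ∘ e.symm) ∘ e = x := by ext; simp
  have h4 : ∑ i, (x ∘ e.symm) i ^ 2 = ∑ i, x i ^ 2 := e.symm.sum_comp fun i => x i ^ 2
  rw [h3] at h1
  rw [h4] at h2
  exact h1.trans h2

theorem signlessRadius_congr [Nonempty V] {G : SimpleGraph V} [DecidableRel G.Adj]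
    {H : SimpleGraph W} [DecidableRel H.Adj] (e : G ≃g H) :
    signlessRadius G = signlessRadius H := by
  have : Nonempty W := e.toEquiv.nonempty_congr.1 inferInstance
  exact le_antisymm
    (signlessRadius_le_of_equiv G H e.toEquiv fun i j h => e.map_adj_iff.2 h)
    (signlessRadius_le_of_equiv H G e.symm.toEquiv fun i j h => e.symm.map_adj_iff.2 h)

end Form

/-! ### Upper bounds in terms of the complement -/

section Bounds

open Matrix

variable {V : Type*} [Fintype V] [DecidableEq V]

/-- If the complement `C` of `G` has nearly `N` edges, spread over vertices of degree `O(√N)`, then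
`q(G)` is well below `2 * N - 2`, as the weights `N - 2 * C.degree v` show. -/
theorem signlessRadius_le_of_compl_degree_le [Nonempty V] (G C : SimpleGraph V)
    [DecidableRel G.Adj] [DecidableRel C.Adj] (hGC : ∀ i j, G.Adj i j ↔ i ≠ j ∧ ¬ C.Adj i j)
    {N k D : ℝ} (hN : 0 < N) (hcard : (Fintype.card V : ℝ) = N + 1)
    (he : N - k ≤ #C.edgeFinset) (hD : ∀ v, (C.degree v : ℝ) ≤ D) (hk : 0 ≤ k)
    (hkD : 4 * k + 4 * D ^ 2 ≤ N) : signlessRadius G ≤ 2 * N - 3 := by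
  set w : V → ℝ := fun v => N - 2 * C.degree v with hw
  have hwpos : ∀ v, 0 < w v := by
    intro v
    have h1 := hD v
    simp only [hw]
    rcases Nat.eq_zero_or_pos (C.degree v) with h | h
    · simp [h, hN]
    · have h2 : (1 : ℝ) ≤ C.degree v := by exact_mod_cast h
      nlinarith
  have hwsum : ∑ v, w v = (N + 1) * N - 4 * #C.edgeFinset := by
    simp only [hw, sum_sub_distrib, ← mul_sum, sum_degree_cast, sum_const, card_univ, nsmul_eq_mul,
      hcard]
    ring
  refine signlessRadius_le_of_forall G fun x => ?_
  have h := signlessForm_le_of_weights G w (fun _ => 2 * N - 3) x hwpos fun i => ?_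
  · rw [← mul_sum] at h
    linarith
  have hrow : (∑ j, if G.Adj i j then w i + w j else 0) =
      ∑ j, (w i + w j) - (w i + w i) - ∑ j, if C.Adj i j then w i + w j else 0 := by
    rw [eq_sub_iff_add_eq, eq_sub_iff_add_eq, ← sum_add_distrib]
    rw [← sum_erase_add univ _ (mem_univ i), ← sum_erase_add univ (fun j => w i + w j) (mem_univ i)]
    simp only [hGC i i, ne_eq, not_true_eq_false, false_and, if_false, C.irrefl, add_zero]
    congr 1
    refine sum_congr rfl fun j hj => ?_
    have hij : i ≠ j := (ne_of_mem_erase hj).symm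
    by_cases hc : C.Adj i j <;> simp [hGC, hij, hc]
  rw [hrow, sum_ite_adj_const_add, sum_add_distrib, hwsum, sum_const, card_univ, nsmul_eq_mul,
    hcard]
  have hT : ∑ j ∈ C.neighborFinset i, (C.degree j : ℝ) ≤ C.degree i * D := by
    rw [← C.card_neighborFinset_eq_degree i, ← nsmul_eq_mul]
    exact sum_le_card_nsmul _ _ _ fun j _ => hD j
  have hCw : ∑ j ∈ C.neighborFinset i, w j =
      C.degree i * N - 2 * ∑ j ∈ C.neighborFinset i, (C.degree j : ℝ) := by
    simp only [hw, sum_sub_distrib, ← mul_sum, sum_const, nsmul_eq_mul,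
      C.card_neighborFinset_eq_degree]
  rw [hCw]
  have hDi := hD i
  have hci : (0 : ℝ) ≤ C.degree i := Nat.cast_nonneg _
  simp only [hw]
  nlinarith

/-- The Feng-Yu bound for the graph `G₀` on the vertices other than `a` (with `a` kept as an
isolated vertex) whose complement there is `C`; it comes from using degrees as weights. -/
theorem signlessForm_le_of_isolated (G₀ C : SimpleGraph V) [DecidableRel G₀.Adj]
    [DecidableRel C.Adj] (a : V)
    (hGC : ∀ i j, G₀.Adj i j ↔ i ≠ j ∧ i ≠ a ∧ j ≠ a ∧ ¬ C.Adj i j) (hCa : C.degree a = 0)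
    {N : ℝ} (hcard : (Fintype.card V : ℝ) = N + 1) (hr : (#C.edgeFinset : ℝ) ≤ N - 2) (x : V → ℝ) :
    signlessForm G₀ x ≤
      2 * ((2 * N - 2 - 2 * #C.edgeFinset / (N - 1)) * (∑ i, x i ^ 2 - x a ^ 2)) := by
  set r : ℝ := (#C.edgeFinset : ℝ) with hrdef
  have hr0 : 0 ≤ r := Nat.cast_nonneg _
  have hdeg : ∀ v, (C.degree v : ℝ) ≤ N - 2 := fun v => by
    refine le_trans ?_ hr
    rw [hrdef, ← C.card_incidenceFinset_eq_degree]
    exact_mod_cast card_le_card (C.incidenceFinset_subset v)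
  have hCa' : ∀ i, ¬ C.Adj i a := by
    intro i h
    have : 0 < C.degree a := (C.degree_pos_iff_exists_adj a).2 ⟨i, h.symm⟩
    omega
  set A : ℝ := 2 * N - 2 - 2 * r / (N - 1) with hA
  set w : V → ℝ := fun v => N - 1 - C.degree v with hw
  have hwpos : ∀ v, 0 < w v := fun v => by
    have := hdeg v
    simp only [hw]
    linarith
  have hwsum : ∑ v, w v = (N + 1) * (N - 1) - 2 * r := by
    simp only [hw, sum_sub_distrib, sum_degree_cast, sum_const, card_univ, nsmul_eq_mul, hcard]
    ring
  have h := signlessForm_le_of_weights G₀ w (fun i => if i = a then 0 else A) x hwpos fun i => ?_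
  · refine h.trans_eq ?_
    rw [← sum_erase_add univ _ (mem_univ a), ← sum_erase_add univ (fun i => x i ^ 2) (mem_univ a)]
    simp only [if_true, zero_mul, add_zero, add_sub_cancel_right]
    rw [mul_sum (univ.erase a) _ A]
    congr 1
    exact sum_congr rfl fun j hj => by rw [if_neg (ne_of_mem_erase hj)]
  by_cases hia : i = a
  · simp [hGC, hia]
  have hrow : (∑ j, if G₀.Adj i j then w i + w j else 0) =
      ∑ j, (w i + w j) - (w i + w i) - (w i + w a) - ∑ j, if C.Adj i j then w i + w j else 0 := by
    rw [eq_sub_iff_add_eq, eq_sub_iff_add_eq, eq_sub_iff_add_eq, ← sum_add_distrib]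
    rw [← sum_erase_add univ _ (mem_univ i), ← sum_erase_add univ (fun j => w i + w j) (mem_univ i)]
    have hai : a ∈ univ.erase i := by simp [Ne.symm hia]
    rw [← sum_erase_add _ _ hai, ← sum_erase_add _ (fun j => w i + w j) hai]
    simp only [hGC i i, hGC i a, ne_eq, not_true_eq_false, false_and, and_false, if_false, C.irrefl,
      hCa', add_zero]
    congr 2
    refine sum_congr rfl fun j hj => ?_
    have hja : j ≠ a := ne_of_mem_erase hj
    have hij : i ≠ j := (ne_of_mem_erase (mem_of_mem_erase hj)).symm
    by_cases hc : C.Adj i j <;> simp [hGC, hij, hc, hia, hja]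
  rw [if_neg hia, hrow, sum_ite_adj_const_add, sum_add_distrib, hwsum, sum_const, card_univ,
    nsmul_eq_mul, hcard]
  have hT : ∑ j ∈ C.neighborFinset i, (C.degree j : ℝ) ≤ C.degree i * (N - 2) := by
    rw [← C.card_neighborFinset_eq_degree i, ← nsmul_eq_mul]
    exact sum_le_card_nsmul _ _ _ fun j _ => hdeg j
  have hT' : ∑ j ∈ C.neighborFinset i, (C.degree j : ℝ) + C.degree i ≤ 2 * r := by
    have hins := sum_insert (f := fun j => (C.degree j : ℝ))
      (fun h => C.irrefl ((C.mem_neighborFinset i i).1 h))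
    rw [← sum_degree_cast, add_comm, ← hins]
    exact sum_le_sum_of_subset_of_nonneg (subset_univ _) fun _ _ _ => Nat.cast_nonneg _
  have hCw : ∑ j ∈ C.neighborFinset i, w j =
      C.degree i * (N - 1) - ∑ j ∈ C.neighborFinset i, (C.degree j : ℝ) := by
    simp only [hw, sum_sub_distrib, sum_const, nsmul_eq_mul, C.card_neighborFinset_eq_degree]
    ring
  rw [hCw]
  have hwa : w a = N - 1 := by simp [hw, hCa]
  have hwi := hwpos i
  have hwi' : w i = N - 1 - C.degree i := rfl
  rw [hwa]
  set T := ∑ j ∈ C.neighborFinset i, (C.degree j : ℝ)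
  set c : ℝ := (C.degree i : ℝ)
  have hc0 : 0 ≤ c := Nat.cast_nonneg _
  have hN1 : 0 < N - 1 := by linarith
  set ρ := 2 * r / (N - 1) with hρ
  have hρ' : ρ * (N - 1) = 2 * r := by rw [hρ]; field_simp
  have hAw : A * w i = (2 * N - 2 - ρ) * (N - 1 - c) := by rw [hA, hwi']
  rw [hAw]
  rw [hwi'] at hwi ⊢
  -- the claim is `T ≤ c * (N - 2 - c) + ρ * c`, where `ρ * (N - 1) ≥ T + c`
  have key : 0 ≤ (N - 1) * (c * (N - 2 - c) + ρ * c - T) := by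
    have h1 : 0 ≤ (N - 1 - c) * (c * (N - 2) - T) := mul_nonneg hwi.le (by linarith)
    have h2 : 0 ≤ c * (2 * r - (T + c)) := mul_nonneg hc0 (by linarith)
    nlinarith
  have key' := nonneg_of_mul_nonneg_right key hN1
  nlinarith

/-- Every entry of an eigenvector for `q(G)` is at most about the mean of the absolute values. -/
theorem sq_entry_le [Nonempty V] (G : SimpleGraph V) [DecidableRel G.Adj] {x : V → ℝ}
    (hx : signlessLapMatrix G *ᵥ x = signlessRadius G • x) {N : ℝ}
    (hcard : (Fintype.card V : ℝ) = N + 1) (hN : 2 ≤ N) (hq : 2 * N - 2 ≤ signlessRadius G)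
    (u : V) : x u ^ 2 * (N - 1) ^ 2 ≤ (N + 1) * ∑ i, x i ^ 2 := by
  set q := signlessRadius G
  have h1 : q * x u = G.degree u * x u + ∑ j ∈ G.neighborFinset u, x j := by
    rw [← sum_ite_adj_const_add, ← signlessLapMatrix_mulVec, hx]
    rfl
  have hdeg : (G.degree u : ℝ) ≤ N := by
    have h2 : (G.degree u : ℝ) + 1 ≤ Fintype.card V := by exact_mod_cast G.degree_lt_card_verts u
    linarith
  have h2 : (q - G.degree u) * |x u| ≤ ∑ j ∈ G.neighborFinset u, |x j| := by
    rw [← abs_of_nonneg (by linarith : (0 : ℝ) ≤ q - G.degree u), ← abs_mul]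
    refine le_trans (le_of_eq ?_) (abs_sum_le_sum_abs _ _)
    congr 1
    linarith
  have h3 : |x u| + ∑ j ∈ G.neighborFinset u, |x j| ≤ ∑ j, |x j| := by
    rw [← sum_insert (f := fun j => |x j|) (fun h => G.irrefl ((G.mem_neighborFinset u u).1 h))]
    exact sum_le_sum_of_subset_of_nonneg (subset_univ _) fun _ _ _ => abs_nonneg _
  have h4 : |x u| * (N - 1) ≤ ∑ j, |x j| := by
    have := abs_nonneg (x u)
    nlinarith
  have h5 : (∑ j, |x j|) ^ 2 ≤ (N + 1) * ∑ i, x i ^ 2 := by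
    have := sq_sum_le_card_mul_sum_sq (s := univ) (f := fun j => |x j|)
    simpa only [card_univ, hcard, sq_abs] using this
  refine le_trans ?_ h5
  rw [← sq_abs (x u), ← mul_pow]
  exact pow_le_pow_left₀ (mul_nonneg (abs_nonneg _) (by linarith)) h4 2

/-- The form of `G` splits into that of `G - a`, bounded by the Feng-Yu bound `A`, and the edges at
`a`. In the latter, `(x a + x j) ^ 2 ≤ x a ^ 2 * A / g + x j ^ 2 * A / (A - g)` balances the entry
at `a` against the main term. -/
theorem signlessRadius_le_of_star [Nonempty V] (G C : SimpleGraph V)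
    [DecidableRel G.Adj] [DecidableRel C.Adj] (hGC : ∀ i j, G.Adj i j ↔ i ≠ j ∧ ¬ C.Adj i j)
    (a : V) {N r A : ℝ} (hcard : (Fintype.card V : ℝ) = N + 1)
    (hr : (#C.edgeFinset : ℝ) - C.degree a = r) (hrN : r ≤ N - 2) (hN : 2 ≤ N)
    (hA : A = 2 * N - 2 - 2 * r / (N - 1))
    (hg0 : (0 : ℝ) < G.degree a) (hgA : (G.degree a : ℝ) < A)
    (hq : 2 * N - 2 ≤ signlessRadius G) :
    signlessRadius G ≤ A + A * G.degree a * (N + 1) / ((A - G.degree a) * (N - 1) ^ 2) := by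
  obtain ⟨x, hx0, hx⟩ := exists_eigenvector G
  have hform := signlessForm_eq_of_mulVec_eq G hx
  have hX := sum_sq_pos hx0
  set X := ∑ i, x i ^ 2 with hXdef
  set g : ℝ := (G.degree a : ℝ) with hg
  have hAg : 0 < A - g := by linarith
  have hA0 : 0 < A := by linarith
  have hN1 : 0 < N - 1 := by linarith
  have hrC : (#(C.deleteIncidenceSet a).edgeFinset : ℝ) = r := by
    rw [C.card_edgeFinset_deleteIncidenceSet, Nat.cast_sub, hr]
    rw [← C.card_incidenceFinset_eq_degree]
    exact card_le_card (C.incidenceFinset_subset a)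
  have hdel := signlessForm_le_of_isolated (G.deleteIncidenceSet a) (C.deleteIncidenceSet a) a
    (by
      intro i j
      simp only [SimpleGraph.deleteIncidenceSet_adj, hGC]
      tauto)
    (by
      by_contra h
      obtain ⟨i, hi⟩ := ((C.deleteIncidenceSet a).degree_pos_iff_exists_adj a).1
        (Nat.pos_of_ne_zero h)
      exact (SimpleGraph.deleteIncidenceSet_adj.1 hi).2.1 rfl) hcard (hrC ▸ hrN) x
  rw [hrC, ← hA] at hdel
  have hsplit : signlessForm G x = signlessForm (G.deleteIncidenceSet a) x +
      2 * ∑ j ∈ G.neighborFinset a, (x a + x j) ^ 2 := by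
    have h1 : ∀ i j, (if G.Adj i j then (x i + x j) ^ 2 else 0) =
        (if (G.deleteIncidenceSet a).Adj i j then (x i + x j) ^ 2 else 0) +
        ((if i = a then (if G.Adj a j then (x a + x j) ^ 2 else 0) else 0) +
          if j = a then (if G.Adj a i then (x a + x i) ^ 2 else 0) else 0) := by
      intro i j
      by_cases hi : i = a
      · by_cases hj : j = a
        · simp [hi, hj]
        · simp [hi, hj, SimpleGraph.deleteIncidenceSet_adj]
      · by_cases hj : j = a
        · simp [hi, hj, SimpleGraph.deleteIncidenceSet_adj, G.adj_comm, add_comm]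
        · simp [hi, hj, SimpleGraph.deleteIncidenceSet_adj]
    have h2 : ∑ j ∈ G.neighborFinset a, (x a + x j) ^ 2 =
        ∑ j, if G.Adj a j then (x a + x j) ^ 2 else 0 := by
      rw [← sum_filter, SimpleGraph.neighborFinset_eq_filter]
    rw [signlessForm, signlessForm, h2]
    rw [sum_congr rfl fun i _ => sum_congr rfl fun j _ => h1 i j]
    simp only [sum_add_distrib]
    rw [sum_comm (f := fun i j => if i = a then (if G.Adj a j then (x a + x j) ^ 2 else 0) else 0)]
    simp only [sum_ite_eq', mem_univ, if_true]
    ring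
  have hstar : ∑ j ∈ G.neighborFinset a, (x a + x j) ^ 2 ≤
      A * x a ^ 2 + A * g * (N + 1) / ((A - g) * (N - 1) ^ 2) * X := by
    have h1 : ∀ j, (x a + x j) ^ 2 ≤
        A / g * x a ^ 2 + A / (A - g) * ((N + 1) * X / (N - 1) ^ 2) := by
      intro j
      have h2 : (x a + x j) ^ 2 ≤ A / g * x a ^ 2 + A / (A - g) * x j ^ 2 := by
        have : A / g * x a ^ 2 + A / (A - g) * x j ^ 2 - (x a + x j) ^ 2 =
            ((A - g) * x a - g * x j) ^ 2 / (g * (A - g)) := by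
          field_simp
          ring
        have h3 : 0 ≤ ((A - g) * x a - g * x j) ^ 2 / (g * (A - g)) := by positivity
        linarith
      have h3 : x j ^ 2 ≤ (N + 1) * X / (N - 1) ^ 2 := by
        rw [le_div_iff₀ (by positivity)]
        exact sq_entry_le G hx hcard hN hq j
      have h4 : 0 ≤ A / (A - g) := by positivity
      exact h2.trans (by gcongr)
    refine (sum_le_card_nsmul _ _ _ fun j _ => h1 j).trans_eq ?_
    rw [G.card_neighborFinset_eq_degree, nsmul_eq_mul, ← hg]
    field_simp
  have hfinal : signlessRadius G * X ≤
      (A + A * g * (N + 1) / ((A - g) * (N - 1) ^ 2)) * X := by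
    rw [add_mul]
    linarith
  exact le_of_mul_le_mul_right hfinal hX

/-- The numerical comparison behind the case of a vertex of large degree `c` in the complement. It
comes down to `(g - k) * (2 * c - 12 - k) > k ^ 2 + 8 * k`, where `g - k` and `c` cannot
both be small as their sum is `N - k`. -/
theorem star_bound_lt {N k g c A : ℝ} (hk : 0 ≤ k) (hgc : g + c = N) (hg : k + 1 ≤ g)
    (hc : N < 4 * k + 4 * c ^ 2) (hc0 : 0 ≤ c) (hN : 10 ^ 6 ≤ N)
    (hkN : 1600 * (k + 1) ^ 2 ≤ N + 1) (hA : A = 2 * N - 2 - 2 * (g - k) / (N - 1)) :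
    2 ≤ c ∧ g < A ∧ A + A * g * (N + 1) / ((A - g) * (N - 1) ^ 2) < 2 * N - 2 + k / N := by
  have hN1 : 0 < N - 1 := by linarith
  have hN0 : 0 < N := by linarith
  have hc1 : 19 * (k + 1) ≤ c := by
    refine (sq_le_sq₀ (by linarith) hc0).1 ?_
    nlinarith
  have hc2 : 100 ≤ c := by
    refine (sq_le_sq₀ (by linarith) hc0).1 ?_
    nlinarith
  have hprod : k ^ 2 + 8 * k < (g - k) * (2 * c - 12 - k) := by
    have h1 : 0 ≤ (g - k - 1) * (c - 1) := mul_nonneg (by linarith) (by linarith)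
    have h2 : k ^ 2 + 8 * k < (g - k) * c := by nlinarith
    refine h2.trans_le (mul_le_mul_of_nonneg_left ?_ (by linarith))
    linarith
  have hAM : 2 * N - 4 ≤ A := by
    have : 2 * (g - k) / (N - 1) ≤ 2 := by
      rw [div_le_iff₀ hN1]
      linarith
    linarith
  have hgA : g < A := by linarith
  refine ⟨by linarith, hgA, ?_⟩
  have hg0 : 0 < g := by linarith
  have hAg : 0 < A - g := by linarith
  have hMg : 0 < 2 * N - 4 - g := by linarith
  have hfrac : A * g * (N + 1) / ((A - g) * (N - 1) ^ 2) ≤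
      (2 * N - 4) * g * (N + 1) / ((2 * N - 4 - g) * (N - 1) ^ 2) := by
    rw [div_le_div_iff₀ (by positivity) (by positivity)]
    have h1 : A * (2 * N - 4 - g) ≤ (2 * N - 4) * (A - g) := by nlinarith
    have h2 : 0 ≤ g * (N + 1) * (N - 1) ^ 2 := by positivity
    calc A * g * (N + 1) * ((2 * N - 4 - g) * (N - 1) ^ 2)
        = A * (2 * N - 4 - g) * (g * (N + 1) * (N - 1) ^ 2) := by ring
      _ ≤ (2 * N - 4) * (A - g) * (g * (N + 1) * (N - 1) ^ 2) :=
          mul_le_mul_of_nonneg_right h1 h2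
      _ = _ := by ring
  have hmain : (2 * N - 4) * g * (N + 1) / ((2 * N - 4 - g) * (N - 1) ^ 2) < (2 * g - k) / N := by
    rw [div_lt_div_iff₀ (by positivity) hN0]
    have h1 : g * (2 * N - 4) + 8 * g < (2 * g - k) * (2 * N - 4 - g) := by
      have hcN : c = N - g := by linarith
      subst hcN
      nlinarith
    have h2 : N ^ 2 * (N + 1) ≤ (N + 4) * (N - 1) ^ 2 := by nlinarith
    have h3 : g * (2 * N - 4) * (N + 4) ≤ (g * (2 * N - 4) + 8 * g) * N := by nlinarith
    have h4 : 0 < (N - 1) ^ 2 := by positivity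
    have h5 : 0 ≤ (2 * N - 4) * g := mul_nonneg (by linarith) hg0.le
    refine lt_of_mul_lt_mul_right ?_ hN0.le
    calc (2 * N - 4) * g * (N + 1) * N * N
        = (2 * N - 4) * g * (N ^ 2 * (N + 1)) := by ring
      _ ≤ (2 * N - 4) * g * ((N + 4) * (N - 1) ^ 2) := mul_le_mul_of_nonneg_left h2 h5
      _ = g * (2 * N - 4) * (N + 4) * (N - 1) ^ 2 := by ring
      _ ≤ (g * (2 * N - 4) + 8 * g) * N * (N - 1) ^ 2 := mul_le_mul_of_nonneg_right h3 h4.le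
      _ < (2 * g - k) * (2 * N - 4 - g) * N * (N - 1) ^ 2 := by gcongr
      _ = (2 * g - k) * ((2 * N - 4 - g) * (N - 1) ^ 2) * N := by ring
  have hlast : (2 * g - k) / N ≤ 2 * (g - k) / (N - 1) + k / N := by
    have h1 : 2 * (g - k) / N ≤ 2 * (g - k) / (N - 1) := by
      refine div_le_div_of_nonneg_left (by linarith) hN1 (by linarith)
    have h2 : (2 * g - k) / N = 2 * (g - k) / N + k / N := by ring
    linarith
  linarith

/-- If the complement `C` has exactly `N - k` edges and no vertex of degree `N - k`, then `q(G)`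
is below the lower bound for `q` of the extremal graph. -/
theorem signlessRadius_lt_of_card_edges [Nonempty V] (G C : SimpleGraph V)
    [DecidableRel G.Adj] [DecidableRel C.Adj] (hGC : ∀ i j, G.Adj i j ↔ i ≠ j ∧ ¬ C.Adj i j)
    {N k : ℕ} (hcard : Fintype.card V = N + 1) (he : #C.edgeFinset + k = N)
    (hdeg : ∀ v, C.degree v + k + 1 ≤ N) (hkN : 1600 * (k + 1) ^ 2 ≤ N + 1) (hN : 10 ^ 6 ≤ N) :
    signlessRadius G < 2 * N - 2 + k / N := by
  obtain ⟨a, -, ha⟩ := (univ : Finset V).exists_max_image (fun v => C.degree v) univ_nonempty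
  have hcard' : (Fintype.card V : ℝ) = N + 1 := by exact_mod_cast hcard
  have he' : (#C.edgeFinset : ℝ) = N - k := by
    rw [eq_sub_iff_add_eq]
    exact_mod_cast he
  have hN' : (10 : ℝ) ^ 6 ≤ N := by exact_mod_cast hN
  have hk0 : (0 : ℝ) ≤ k := Nat.cast_nonneg _
  have hkN0 : 0 ≤ (k : ℝ) / N := by positivity
  have hc0 : (0 : ℝ) ≤ C.degree a := Nat.cast_nonneg _
  have hkN' : 1600 * ((k : ℝ) + 1) ^ 2 ≤ N + 1 := by exact_mod_cast hkN
  by_cases hD : 4 * (k : ℝ) + 4 * (C.degree a : ℝ) ^ 2 ≤ N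
  · have := signlessRadius_le_of_compl_degree_le G C hGC (N := N) (k := k) (D := C.degree a)
      (by linarith) hcard' he'.ge (fun v => by exact_mod_cast ha v (mem_univ v)) hk0 hD
    linarith
  push Not at hD
  by_contra! hq
  have hga : G.degree a + C.degree a = N := by
    have h1 : G.neighborFinset a = (insert a (C.neighborFinset a))ᶜ := by
      ext v
      simp only [SimpleGraph.mem_neighborFinset, hGC, mem_compl, mem_insert, not_or, ne_eq,
        eq_comm (a := v)]
    have h2 := card_compl (insert a (C.neighborFinset a))
    rw [← h1, card_insert_of_notMem (by simp), hcard, G.card_neighborFinset_eq_degree,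
      C.card_neighborFinset_eq_degree] at h2
    have h3 := hdeg a
    clear hN hkN
    omega
  have hga' : (G.degree a : ℝ) + C.degree a = N := by exact_mod_cast hga
  have hgk : (k : ℝ) + 1 ≤ G.degree a := by
    have := hdeg a
    exact_mod_cast (by omega : k + 1 ≤ G.degree a)
  obtain ⟨hc2, hgA, hlt⟩ := star_bound_lt hk0 hga' hgk hD hc0 hN' hkN' rfl
  have := signlessRadius_le_of_star G C hGC a (N := N) (r := G.degree a - k) hcard'
    (by rw [he']; linarith) (by linarith) (by linarith) rfl (by linarith) hgA (by linarith)
  linarith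

end Bounds

/-! ### The extremal graph -/

section Extremal

open Matrix

theorem cliquePendant_adj {n k : ℕ} {i j : Fin n} : (cliquePendant n k).Adj i j ↔
    i ≠ j ∧ (i.val = 0 → j.val < k) ∧ (j.val = 0 → i.val < k) := Iff.rfl

/-- The indicator vector of the clique as a test vector. -/
theorem le_signlessRadius_cliquePendant {N k : ℕ} (hN : 0 < N) (hk : k ≤ N) :
    2 * (N : ℝ) - 2 + k / N ≤ signlessRadius (cliquePendant (N + 1) (k + 1)) := by
  let x : Fin (N + 1) → ℝ := fun i => if i = 0 then 0 else 1
  have hx : ∑ i, x i ^ 2 = N := by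
    rw [Fin.sum_univ_succ]
    simp [x, Fin.succ_ne_zero]
  have hcount : (∑ j : Fin N, if (j : ℕ) < k then (1 : ℝ) else 0) = k := by
    rw [← sum_filter, sum_const, nsmul_eq_mul, mul_one, Fin.card_filter_val_lt, min_eq_right hk]
  have hrow : ∀ i : Fin N, (∑ j : Fin N, if i ≠ j then (4 : ℝ) else 0) = 4 * (N - 1) := by
    intro i
    rw [← sum_filter, sum_const, filter_ne, card_erase_of_mem (mem_univ i), card_univ,
      Fintype.card_fin, nsmul_eq_mul, Nat.cast_sub hN]
    push_cast
    ring
  have hform : signlessForm (cliquePendant (N + 1) (k + 1)) x = 4 * (N - 1) * N + 2 * k := by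
    have h0 : ∀ j : Fin N, (if (cliquePendant (N + 1) (k + 1)).Adj 0 j.succ then
        (x 0 + x j.succ) ^ 2 else 0) = if (j : ℕ) < k then (1 : ℝ) else 0 := by
      intro j
      simp [cliquePendant_adj, x, Fin.succ_ne_zero, (Fin.succ_ne_zero j).symm]
    have h0' : ∀ j : Fin N, (if (cliquePendant (N + 1) (k + 1)).Adj j.succ 0 then
        (x j.succ + x 0) ^ 2 else 0) = if (j : ℕ) < k then (1 : ℝ) else 0 := by
      intro j
      simp [cliquePendant_adj, x, Fin.succ_ne_zero]
    have h1 : ∀ i j : Fin N, (if (cliquePendant (N + 1) (k + 1)).Adj i.succ j.succ then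
        (x i.succ + x j.succ) ^ 2 else 0) = if i ≠ j then (4 : ℝ) else 0 := by
      intro i j
      simp only [cliquePendant_adj, x, Fin.succ_ne_zero, Fin.val_succ, if_false, ne_eq,
        Fin.succ_inj, Nat.add_eq_zero_iff, one_ne_zero, and_false, false_imp_iff, and_true]
      norm_num
    rw [signlessForm, Fin.sum_univ_succ, Fin.sum_univ_succ]
    simp only [Fin.sum_univ_succ (n := N), h0, h0', h1, hrow, sum_add_distrib, hcount, sum_const,
      card_univ, Fintype.card_fin, nsmul_eq_mul, SimpleGraph.irrefl, if_false]
    ring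
  have h := signlessForm_le (cliquePendant (N + 1) (k + 1)) x
  rw [hform, hx] at h
  have hN' : (0 : ℝ) < N := by exact_mod_cast hN
  have : (2 * (N : ℝ) - 2 + k / N) * N ≤ signlessRadius (cliquePendant (N + 1) (k + 1)) * N := by
    have : (2 * (N : ℝ) - 2 + k / N) * N = 2 * (N - 1) * N + k := by
      field_simp
    linarith
  exact le_of_mul_le_mul_right this hN'

/-- A graph with a vertex of degree less than `d` is isomorphic to a subgraph of
`cliquePendant n d`. -/
theorem exists_perm_cliquePendant {n d : ℕ} (hdn : d ≤ n) (G : SimpleGraph (Fin n))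
    [DecidableRel G.Adj] (v : Fin n) (hv : G.degree v < d) :
    ∃ e : Equiv.Perm (Fin n), ∀ i j, G.Adj i j → (cliquePendant n d).Adj (e i) (e j) := by
  obtain ⟨S, hS, hScard⟩ : ∃ S, insert v (G.neighborFinset v) ⊆ S ∧ #S = d := by
    refine exists_superset_card_eq ?_ (by simpa using hdn)
    rw [card_insert_of_notMem (by simp), G.card_neighborFinset_eq_degree]
    exact hv
  let T : Finset (Fin n) := {i | i.val < d}
  have hT : #T = d := by simp [T, Fin.card_filter_val_lt, hdn]
  have hn : 0 < n := v.pos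
  let o : Fin n := ⟨0, hn⟩
  have hoT : o ∈ T := by simp only [T, o, mem_filter, mem_univ, true_and]; omega
  let e₀ : Equiv.Perm (Fin n) := (Finset.equivOfCardEq (hScard.trans hT.symm)).extendSubtype
  have he₀ : ∀ i ∈ S, e₀ i ∈ T := fun i hi =>
    (Finset.equivOfCardEq (hScard.trans hT.symm)).extendSubtype_mem i hi
  have hvS : v ∈ S := hS (mem_insert_self _ _)
  let e : Equiv.Perm (Fin n) := e₀.trans (Equiv.swap (e₀ v) o)
  have hev : e v = o := by simp [e]
  have heS : ∀ i ∈ S, (e i).val < d := by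
    intro i hi
    have h : e i ∈ T := by
      simp only [e, Equiv.trans_apply]
      by_cases h1 : e₀ i = e₀ v
      · rw [h1, Equiv.swap_apply_left]; exact hoT
      · by_cases h2 : e₀ i = o
        · rw [h2, Equiv.swap_apply_right]; exact he₀ v hvS
        · rw [Equiv.swap_apply_of_ne_of_ne h1 h2]; exact he₀ i hi
    simpa [T] using h
  have key : ∀ i j, G.Adj i j → (e i).val = 0 → (e j).val < d := by
    intro i j hij hi
    have : i = v := e.injective (by rw [hev]; exact Fin.ext hi)
    subst this
    exact heS j (hS (mem_insert_of_mem (by simpa using hij)))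
  exact ⟨e, fun i j hij => ⟨e.injective.ne hij.ne, key i j hij, key j i hij.symm⟩⟩

/-- A spanning subgraph of `cliquePendant n d` with the same largest eigenvalue is the whole graph:
a maximizing vector can be taken nonnegative, and it is then an eigenvector for
`cliquePendant n d` that is positive on the clique, while each edge has an end there. -/
theorem nonempty_iso_of_signlessRadius_eq {n d : ℕ} (hn : 2 ≤ n) (G : SimpleGraph (Fin n))
    [DecidableRel G.Adj] (e : Equiv.Perm (Fin n))
    (he : ∀ i j, G.Adj i j → (cliquePendant n d).Adj (e i) (e j))
    (hq : signlessRadius G = signlessRadius (cliquePendant n d))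
    (hpos : 0 < signlessRadius (cliquePendant n d)) :
    Nonempty (G ≃g cliquePendant n d) := by
  have : Nonempty (Fin n) := ⟨⟨0, by omega⟩⟩
  set H := cliquePendant n d with hH
  obtain ⟨x, hx0, hx⟩ := exists_eigenvector G
  set y : Fin n → ℝ := fun i => |x (e.symm i)| with hy
  have hy0 : ∀ i, 0 ≤ y i := fun i => abs_nonneg _
  have hye : y ∘ e = fun i => |x i| := by ext; simp [hy]
  have hysum : ∑ i, y i ^ 2 = ∑ i, x i ^ 2 := by
    simp only [hy, sq_abs]
    exact e.symm.sum_comp fun i => x i ^ 2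
  have h1 := signlessForm_eq_of_mulVec_eq G hx
  have h2 := signlessForm_le_abs G x
  have h3 := signlessForm_comp_equiv_le G H e he y
  have h4 := signlessForm_le H y
  rw [hye] at h3
  rw [hysum, ← hq] at h4
  have hGH : signlessForm G (y ∘ e) = signlessForm H y := by rw [hye]; linarith
  have hHy : signlessForm H y = 2 * signlessRadius H * ∑ i, y i ^ 2 := by
    rw [hysum, ← hq]; linarith
  have hev := mulVec_eq_of_signlessForm_eq H y hHy
  have hrow : ∀ i, (∑ j, if H.Adj i j then y i + y j else 0) = signlessRadius H * y i := by
    intro i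
    rw [← signlessLapMatrix_mulVec, hev]
    rfl
  have hzero : ∀ i j, H.Adj i j → y i = 0 → y j = 0 := by
    intro i j hij hi
    have h5 := hrow i
    rw [hi, mul_zero, sum_eq_zero_iff_of_nonneg] at h5
    · simpa [hij] using h5 j (mem_univ j)
    · intro j _
      split_ifs
      · simpa using hy0 j
      · exact le_rfl
  have hcl : ∀ i : Fin n, i.val ≠ 0 → 0 < y i := by
    intro i hi
    refine lt_of_le_of_ne (hy0 i) fun hi0 => ?_
    have hall : ∀ j : Fin n, j.val ≠ 0 → y j = 0 := by
      intro j hj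
      by_cases hij : i = j
      · rw [← hij, hi0]
      · exact hzero i j ⟨hij, fun h => absurd h hi, fun h => absurd h hj⟩ hi0.symm
    have hall' : ∀ j, y j = 0 := by
      intro j
      by_cases hj : j.val = 0
      · have h5 := hrow j
        by_cases hex : ∃ l, H.Adj j l
        · obtain ⟨l, hl⟩ := hex
          refine hzero l j hl.symm (hall l fun hl0 => hl.ne (Fin.ext (hj.trans hl0.symm)))
        · push Not at hex
          simp only [hex, if_false, sum_const_zero] at h5
          exact (mul_eq_zero.1 h5.symm).resolve_left hpos.ne'
      · exact hall j hj
    have := sum_sq_pos hx0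
    rw [← hysum] at this
    simp [hall'] at this
  -- an edge of `H` outside the image of `G` would make the form of `H` strictly larger
  refine ⟨⟨e, fun {i j} => ⟨fun hij => ?_, he i j⟩⟩⟩
  by_contra hG
  have hlt : signlessForm G (y ∘ e) < signlessForm H y := by
    have hle : ∀ i j, (if G.Adj i j then ((y ∘ e) i + (y ∘ e) j) ^ 2 else 0) ≤
        if H.Adj (e i) (e j) then (y (e i) + y (e j)) ^ 2 else 0 := by
      intro i j
      split_ifs with h5 h6 h6
      · exact le_rfl
      · exact absurd (he i j h5) h6
      · positivity
      · exact le_rfl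
    have hformH : signlessForm H y =
        ∑ i, ∑ j, if H.Adj (e i) (e j) then (y (e i) + y (e j)) ^ 2 else 0 := by
      rw [signlessForm, ← Equiv.sum_comp e]
      exact sum_congr rfl fun i _ => (Equiv.sum_comp e _).symm
    rw [hformH, signlessForm]
    refine sum_lt_sum (fun i _ => sum_le_sum fun j _ => hle i j) ⟨i, mem_univ i, ?_⟩
    refine sum_lt_sum (fun j _ => hle i j) ⟨j, mem_univ j, ?_⟩
    rw [if_neg hG, if_pos hij]
    have hsum : 0 < y (e i) + y (e j) := by
      by_cases hi : (e i).val = 0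
      · have hj : (e j).val ≠ 0 := fun hj => hij.ne (Fin.ext (hi.trans hj.symm))
        have := hcl _ hj
        have := hy0 (e i)
        linarith
      · have := hcl _ hi
        have := hy0 (e j)
        linarith
    positivity
  exact hlt.ne hGH

theorem degree_cliquePendant_zero_lt {n d : ℕ} (hn : 0 < n) (hd : 1 ≤ d) :
    (cliquePendant n d).degree ⟨0, hn⟩ < d := by
  rw [← SimpleGraph.card_neighborFinset_eq_degree]
  have hsub : insert (0 : ℕ) (((cliquePendant n d).neighborFinset ⟨0, hn⟩).map Fin.valEmbedding) ⊆
      range d := by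
    intro m hm
    rcases mem_insert.1 hm with rfl | hm
    · exact mem_range.2 hd
    · obtain ⟨j, hj, rfl⟩ := mem_map.1 hm
      rw [SimpleGraph.mem_neighborFinset] at hj
      simpa using hj.2.1 rfl
  have hcard := card_le_card hsub
  rw [card_insert_of_notMem, card_map, card_range] at hcard
  · exact hcard
  · intro hm
    obtain ⟨j, hj, hj0⟩ := mem_map.1 hm
    rw [SimpleGraph.mem_neighborFinset] at hj
    exact hj.1 (Fin.ext hj0.symm)

theorem free_cliquePendant {n : ℕ} (hn : 0 < n) (F : SimpleGraph (Fin n)) [DecidableRel F.Adj]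
    (hd : 1 ≤ F.minDegree) : F.Free (cliquePendant n F.minDegree) := by
  rintro ⟨f⟩
  have hbij : Function.Bijective f := Finite.injective_iff_bijective.1 f.injective
  obtain ⟨v, hv⟩ := hbij.2 ⟨0, hn⟩
  have h1 := degree_cliquePendant_zero_lt hn hd
  have h2 : F.degree v ≤ (cliquePendant n F.minDegree).degree ⟨0, hn⟩ := by
    rw [← SimpleGraph.card_neighborFinset_eq_degree, ← SimpleGraph.card_neighborFinset_eq_degree]
    refine card_le_card_of_injOn f (fun u hu => ?_) f.injective.injOn
    simp only [mem_coe, SimpleGraph.mem_neighborFinset] at hu ⊢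
    rw [← hv]
    exact f.toHom.map_adj hu
  have h3 := F.minDegree_le_degree v
  omega

end Extremal

/-! ### Comparison with the extremal graph -/

/-- With at least `n - d` edges missing, but every degree at least `d`, the largest eigenvalue is
smaller than that of `cliquePendant n d`: restore edges until exactly `n - d` are missing. -/
theorem signlessRadius_lt_cliquePendant {N k : ℕ} (hkN : 1600 * (k + 1) ^ 2 ≤ N + 1)
    (hN : 10 ^ 6 ≤ N) (G : SimpleGraph (Fin (N + 1))) [DecidableRel G.Adj]
    (he : N ≤ #Gᶜ.edgeFinset + k) (hdeg : ∀ v, k + 1 ≤ G.degree v) :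
    signlessRadius G < signlessRadius (cliquePendant (N + 1) (k + 1)) := by
  classical
  have hN0 : 2 ≤ N := le_trans (by norm_num) hN
  have hk : k ≤ N := by
    have := Nat.le_self_pow two_ne_zero (k + 1)
    clear hN
    omega
  obtain ⟨S, hS, hScard⟩ := exists_subset_card_eq (Nat.sub_le_iff_le_add.2 he)
  obtain ⟨C, hC⟩ : ∃ C, C = SimpleGraph.fromEdgeSet (S : Set (Sym2 (Fin (N + 1)))) := ⟨_, rfl⟩
  have hCG : C ≤ Gᶜ := by
    intro i j hij
    rw [hC] at hij
    have h1 := ((SimpleGraph.fromEdgeSet_adj _).1 hij).1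
    exact SimpleGraph.mem_edgeFinset.1 (hS h1)
  have hCe : C.edgeFinset = S := by
    ext e
    rw [SimpleGraph.mem_edgeFinset, hC, SimpleGraph.edgeSet_fromEdgeSet, Set.mem_sdiff, mem_coe]
    exact ⟨fun h => h.1, fun h => ⟨h, fun hd =>
      Gᶜ.not_isDiag_of_mem_edgeSet (SimpleGraph.mem_edgeFinset.1 (hS h)) hd⟩⟩
  have hle : signlessRadius G ≤ signlessRadius Cᶜ :=
    signlessRadius_le_of_equiv G Cᶜ (Equiv.refl _) fun i j hij =>
      (SimpleGraph.compl_adj C i j).2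
        ⟨hij.ne, fun h => ((SimpleGraph.compl_adj G i j).1 (hCG h)).2 hij⟩
  have hlt := signlessRadius_lt_of_card_edges Cᶜ C (fun i j => SimpleGraph.compl_adj C i j)
    (N := N) (k := k) (by simp) (by rw [hCe, hScard]; exact Nat.sub_add_cancel hk) (fun v => by
      have h1 : C.degree v ≤ Gᶜ.degree v := SimpleGraph.degree_le_of_le hCG
      have h2 := G.degree_compl v
      have h3 := hdeg v
      have h4 := G.degree_lt_card_verts v
      rw [Fintype.card_fin] at h2 h4
      clear hN
      omega) hkN hN
  exact hle.trans_lt (hlt.trans_le (le_signlessRadius_cliquePendant (two_pos.trans_le hN0) hk))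

/-- A graph on `n` vertices with fewer than `n - F.minDegree` edges missing contains `F`. -/
theorem isContained_of_card_edges {V : Type*} [Fintype V] [DecidableEq V] [Nonempty V]
    (F G : SimpleGraph V) [DecidableRel F.Adj] [DecidableRel G.Adj] (hΔ : 1 ≤ F.maxDegree)
    (hn : 1600 * F.maxDegree ^ 2 ≤ Fintype.card V)
    (he : #Gᶜ.edgeFinset + F.minDegree + 1 ≤ Fintype.card V) : F.IsContained G := by
  obtain ⟨w, hw⟩ := F.exists_minimal_degree_vertex
  rw [hw] at he
  obtain ⟨φ, hφ⟩ := exists_packing F Gᶜ w hΔ hn he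
  refine ⟨⟨⟨φ.symm, fun {x y} hxy => ?_⟩, φ.symm.injective⟩⟩
  by_contra h
  refine hφ (φ.symm x) (φ.symm y) ?_ (by simpa using hxy)
  exact (SimpleGraph.compl_adj G _ _).2 ⟨φ.symm.injective.ne hxy.ne, h⟩

end SignlessLaplacian

theorem mainTheorem2 :
    ∃ n₀ : ℕ, ∀ n : ℕ, n₀ ≤ n →
      ∀ (F : SimpleGraph (Fin n)) [DecidableRel F.Adj],
        (∀ v, ¬ F.IsIsolated v) →
        (F.maxDegree : ℝ) ≤ Real.sqrt (n : ℝ) / 40 →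
        F.Free (SignlessLaplacian.cliquePendant n F.minDegree) ∧
        ∀ (G : SimpleGraph (Fin n)) [DecidableRel G.Adj], F.Free G →
          SignlessLaplacian.signlessRadius G ≤
              SignlessLaplacian.signlessRadius
                (SignlessLaplacian.cliquePendant n F.minDegree) ∧
          (SignlessLaplacian.signlessRadius G =
              SignlessLaplacian.signlessRadius
                (SignlessLaplacian.cliquePendant n F.minDegree) ↔
            Nonempty (G ≃g SignlessLaplacian.cliquePendant n F.minDegree)) := by
  -- `star_bound_lt` needs `10 ^ 6 ≤ N`
  refine ⟨10 ^ 6 + 1, fun n hn F _ hiso hΔ => ?_⟩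
  obtain ⟨N, rfl⟩ : ∃ N, n = N + 1 :=
    Nat.exists_eq_succ_of_ne_zero (Nat.pos_of_ne_zero (by rintro rfl; simp at hn)).ne'
  have hN : 10 ^ 6 ≤ N := Nat.le_of_succ_le_succ hn
  clear hn
  have hN2 : 2 ≤ N := le_trans (by norm_num) hN
  have hδ : 1 ≤ F.minDegree := by
    obtain ⟨v, hv⟩ := F.exists_minimal_degree_vertex
    rw [hv]
    refine (F.degree_pos_iff_exists_adj v).2 ?_
    simpa [SimpleGraph.IsIsolated] using hiso v
  have hδΔ : F.minDegree ≤ F.maxDegree := F.minDegree_le_maxDegree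
  have hΔn : 1600 * F.maxDegree ^ 2 ≤ N + 1 := by
    have h1 : (40 * (F.maxDegree : ℝ)) ^ 2 ≤ ((N + 1 : ℕ) : ℝ) := by
      rw [← Real.le_sqrt (by positivity) (by positivity)]
      linarith
    have h2 : ((1600 * F.maxDegree ^ 2 : ℕ) : ℝ) ≤ ((N + 1 : ℕ) : ℝ) := by
      refine le_trans (le_of_eq ?_) h1
      push_cast
      ring
    exact_mod_cast h2
  refine ⟨SignlessLaplacian.free_cliquePendant (Nat.succ_pos N) F hδ, fun G _ hFG => ?_⟩
  obtain ⟨k, hk⟩ : ∃ k, F.minDegree = k + 1 := ⟨F.minDegree - 1, (Nat.sub_add_cancel hδ).symm⟩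
  have hkN : 1600 * (k + 1) ^ 2 ≤ N + 1 := by
    rw [← hk]
    exact (Nat.mul_le_mul_left _ (Nat.pow_le_pow_left hδΔ 2)).trans hΔn
  have he : N ≤ Gᶜ.edgeFinset.card + k := by
    by_contra! hlt
    refine hFG (SignlessLaplacian.isContained_of_card_edges F G (hδ.trans hδΔ)
      (by simpa using hΔn) ?_)
    rw [hk, Fintype.card_fin]
    clear hN
    omega
  rw [hk]
  have hkN' : k + 1 ≤ N + 1 := by
    have := Nat.le_self_pow two_ne_zero (k + 1)
    clear hN
    omega
  by_cases hdeg : ∀ v, k + 1 ≤ G.degree v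
  · have hlt := SignlessLaplacian.signlessRadius_lt_cliquePendant hkN hN G he hdeg
    exact ⟨hlt.le, fun h => absurd h hlt.ne,
      fun ⟨e⟩ => SignlessLaplacian.signlessRadius_congr e⟩
  · push Not at hdeg
    obtain ⟨v, hv⟩ := hdeg
    obtain ⟨e, he⟩ := SignlessLaplacian.exists_perm_cliquePendant hkN' G v hv
    refine ⟨SignlessLaplacian.signlessRadius_le_of_equiv _ _ e he, fun h =>
      SignlessLaplacian.nonempty_iso_of_signlessRadius_eq (by clear hN; omega) G e he h ?_,
      fun ⟨e⟩ => SignlessLaplacian.signlessRadius_congr e⟩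
    refine lt_of_lt_of_le ?_
      (SignlessLaplacian.le_signlessRadius_cliquePendant (two_pos.trans_le hN2)
        (Nat.le_of_succ_le_succ hkN'))
    have h1 : (2 : ℝ) ≤ N := by exact_mod_cast hN2
    have h2 : (0 : ℝ) ≤ k / N := by positivity
    linarith
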